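/- Let $F$ be a probability measure on $\mathbb{R}$; write $F(x)=F((-\infty,x])$, $\overline F(x)=1-F(x)$, and let $F^{*n}$ be its $n$-fold self-convolution, with $F^{*0}$ the unit mass at $0$. For $\rho\in\mathbb{R}$ let $\mathcal{R}_\rho$ be the class of measurable functions $f$ that are strictly positive on $(0,\infty)$ and regularly varying at $\infty$ with exponent $\rho$, i.e. $f(cx)/f(x)\to c^\rho$ as $x\to\infty$ for every $c>0$, and let $\mathcal{R}=\bigcup_\rho\mathcal{R}_\rho$. Let $h>0$ be arbitrary if $F$ is not concentrated on any lattice $d\mathbb{Z}$ with $d>0$, and otherwise let $h$ be the largest $d>0$ such that $F$ is concentrated on $d\mathbb{Z}$. Put $I=(0,h]$ and $\omega(x)=xF(x+I)/\overline F(x)$. As $x\to\infty$, $u(x)\ll v(x)$ (equivalently $v(x)\gg u(x)$) means that $|u(x)|\le C|v(x)|$ for some constant $C$ and all sufficiently large $x$. Let $\alpha\in(0,1/2]$ and suppose that $\overline F(x)\sim 1/A(x)$ as $x\to\infty$ for some $A\in\mathcal{R}_\alpha$. Suppose there is a non-decreasing function $M\in\mathcal{R}_\beta$ with $\beta\in[1-2\alpha,1]$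 such that, as $x\to\infty$, $$\omega(x)\ll \frac{x}{M(x)}=o(A(x)^2).$$ Let $g(x)=A(x)\sqrt{M(x)/x}$. For $\theta>0$ and $L\in\mathcal{R}$ consider $$\limsup_{x\to\infty}\frac{x}{A(x)}\sum_{0\le n<L(x)}\ \sup_{t\ge\theta x}F^{*n}(t+I)=0.\qquad(\ast)$$ Then the following are true. 1) If there is $\gamma>\alpha+\beta$ such that $g(x)\gg(\ln x)^\gamma$, then for any $\theta>0$, $(\ast)$ holds for any non-decreasing $L\in\mathcal{R}$ that satisfies $L(x)\ll g(x)/(\ln x)^\gamma$. 2) Given $\epsilon\in(0,1/(1+\alpha+\beta))$, for any $\theta>0$, $(\ast)$ holds for any non-decreasing $L\in\mathcal{R}$ that satisfies $1\ll L(x)\ll g(x)^\epsilon$. -/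

import Mathlib

open MeasureTheory ProbabilityTheory Filter Set Asymptotics Topology

noncomputable section

/-- Regular variation at infinity with exponent `ρ`, for functions on `(0, ∞)` that are strictly
positive there; values outside `(0, ∞)` are irrelevant. -/
structure IsRegVar (ρ : ℝ) (f : ℝ → ℝ) : Prop where
  pos : ∀ x, 0 < x → 0 < f x
  measurable : Measurable ((Ioi (0 : ℝ)).domRestrict f)
  tendsto : ∀ c, 0 < c → Tendsto (fun x => f (c * x) / f x) atTop (𝓝 (c ^ ρ))

/-- The `n`-fold self-convolution of `F`; the `0`-fold one is the unit mass at `0`. -/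
def convPow (F : Measure ℝ) : ℕ → Measure ℝ
  | 0 => Measure.dirac 0
  | n + 1 => (convPow F n).conv F

/-- `F` is concentrated on the lattice `d ℤ`. -/
def ConcentratedOn (F : Measure ℝ) (d : ℝ) : Prop :=
  F (AddSubgroup.zmultiples d : Set ℝ)ᶜ = 0

/-- `h` is an admissible window length: any positive number if `F` is non-arithmetic, and the span
of `F` (the largest `d > 0` with `F` concentrated on `d ℤ`) if `F` is arithmetic. -/
def IsWindow (F : Measure ℝ) (h : ℝ) : Prop :=
  0 < h ∧ ((∃ d, 0 < d ∧ ConcentratedOn F d) → IsGreatest {d | 0 < d ∧ ConcentratedOn F d} h)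

/-- The right tail `1 - F(x)`. -/
def tailFn (F : Measure ℝ) (x : ℝ) : ℝ := 1 - cdf F x

/-- `ω(x) = x F((x, x + h]) / (1 - F(x))`. -/
def omegaFn (F : Measure ℝ) (h x : ℝ) : ℝ := x * F.real (Ioc x (x + h)) / tailFn F x

/-- The uniform cutoff property for the cutoff function `L` and the constant `θ`:
`limsup_{x → ∞} (x / A(x)) ∑_{n < L(x)} sup_{t ≥ θ x} F^{*n}((t, t + h]) = 0`.
Note that `n ∈ Finset.range ⌈L x⌉₊` means exactly `(n : ℝ) < L x`. -/
def UniformCutoff (F : Measure ℝ) (A : ℝ → ℝ) (h θ : ℝ) (L : ℝ → ℝ) : Prop :=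
  limsup (fun x : ℝ => ENNReal.ofReal (x / A x) *
    ∑ n ∈ Finset.range ⌈L x⌉₊, ⨆ t ∈ Ici (θ * x), convPow F n (Ioc t (t + h))) atTop = 0

end

open scoped ENNReal

/-! A sum of `n < L(x)` steps lands in a window beyond `θx` either with some step above a level `z`,
or with all steps at most `z`. Write `T` for the tail of `F`.

A big step costs at most `n * a`, where `a` bounds `F` on the windows meeting `(z, ∞)`:
conditionally on the other steps, the big one must hit a prescribed window. The hypothesis on `ω`
gives `a ≪ T(z/2) / M(z/2)` (`convPow_Ioc_le_truncated`).

Without big steps, Chernoff's bound with parameter `λ = (6/θ) log x / x` applies. The truncated mean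
is `O(x T(x))` (Karamata, using `α < 1`), so as soon as `L(x) T(x) exp(λz) → 0` the contribution is
at most `x⁻³`.

Summing over `n`, it remains that `L² · x T(x) · T(z/2) / M(z/2) → 0`; this is
`uniformCutoff_of_truncation`. A Potter bound for `M / T`, of index `α + β`, moves the last factor
from `z/2` to `x`, where `g² · x T² / M = (A T)² → 1`. What is left is the choice of `z`. Taking `z
= x / log x` keeps `exp(λz)` constant and costs `(log x)^γ` in the Potter bound. Taking `z = δx`
makes the Potter cost constant and `exp(λz)` a small power of `x`, absorbed by the margin `ε < 1`.
-/

instance isFiniteMeasure_convPow (F : Measure ℝ) [IsFiniteMeasure F] (n : ℕ) :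
    IsFiniteMeasure (convPow F n) := by
  induction n with
  | zero => exact inferInstanceAs (IsFiniteMeasure (Measure.dirac (0 : ℝ)))
  | succ n ih => exact inferInstanceAs (IsFiniteMeasure ((convPow F n).conv F))

instance isProbabilityMeasure_convPow (F : Measure ℝ) [IsProbabilityMeasure F] (n : ℕ) :
    IsProbabilityMeasure (convPow F n) := by
  induction n with
  | zero => exact inferInstanceAs (IsProbabilityMeasure (Measure.dirac (0 : ℝ)))
  | succ n ih => exact inferInstanceAs (IsProbabilityMeasure ((convPow F n).conv F))

/-! ### Convolution powers: truncation and Chernoff bounds. -/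

theorem conv_Ioc_apply (μ ν : Measure ℝ) [SFinite ν] (t h : ℝ) :
    (μ.conv ν) (Ioc t (t + h)) = ∫⁻ s, ν (Ioc (t - s) (t - s + h)) ∂μ := by
  rw [← lintegral_indicator_one measurableSet_Ioc,
    Measure.lintegral_conv (measurable_one.indicator measurableSet_Ioc)]
  refine lintegral_congr fun s => ?_
  rw [← lintegral_indicator_one measurableSet_Ioc]
  refine lintegral_congr fun y => ?_
  simp only [indicator, mem_Ioc]
  congr 1
  apply propext
  constructor <;> rintro ⟨h1, h2⟩ <;> constructor <;> linarith

/-- Splitting off the last summand exceeding `z`: a local bound for convolution powers. -/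
theorem convPow_Ioc_le_truncated (F : Measure ℝ) [IsProbabilityMeasure F] (h z : ℝ) (a : ℝ≥0∞)
    (ha : ∀ u, F.restrict (Ioi z) (Ioc u (u + h)) ≤ a) (n : ℕ) (t : ℝ) :
    convPow F n (Ioc t (t + h)) ≤
      n * a + convPow (F.restrict (Iic z)) n (Ioc t (t + h)) := by
  induction n generalizing t with
  | zero => simp [convPow]
  | succ n ih =>
    have hsplit : F = F.restrict (Iic z) + F.restrict (Ioi z) := by
      rw [← compl_Iic, Measure.restrict_add_restrict_compl measurableSet_Iic]
    have hp : F.restrict (Iic z) univ ≤ 1 :=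
      (Measure.restrict_apply_le _ _).trans prob_le_one
    have h1 : (convPow F n).conv (F.restrict (Ioi z)) (Ioc t (t + h)) ≤ a := by
      rw [conv_Ioc_apply]
      calc ∫⁻ s, F.restrict (Ioi z) (Ioc (t - s) (t - s + h)) ∂(convPow F n)
          ≤ ∫⁻ _, a ∂(convPow F n) := lintegral_mono fun s => ha _
        _ = a := by simp
    have h2 : (convPow F n).conv (F.restrict (Iic z)) (Ioc t (t + h)) ≤
        n * a + convPow (F.restrict (Iic z)) (n + 1) (Ioc t (t + h)) := by
      change _ ≤ n * a + (convPow (F.restrict (Iic z)) n).conv (F.restrict (Iic z)) _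
      -- Commuting the factors puts the truncated step on the outside, so that the induction
      -- hypothesis applies to the inner measure at the shifted point `t - s`.
      rw [Measure.conv_comm, conv_Ioc_apply,
        Measure.conv_comm (convPow (F.restrict (Iic z)) n), conv_Ioc_apply]
      calc ∫⁻ s, convPow F n (Ioc (t - s) (t - s + h)) ∂(F.restrict (Iic z))
          ≤ ∫⁻ s, (n * a + convPow (F.restrict (Iic z)) n (Ioc (t - s) (t - s + h)))
              ∂(F.restrict (Iic z)) := lintegral_mono fun s => ih _
        _ = n * a * F.restrict (Iic z) univ + ∫⁻ s, convPow (F.restrict (Iic z)) n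
              (Ioc (t - s) (t - s + h)) ∂(F.restrict (Iic z)) := by
            rw [lintegral_add_left measurable_const, lintegral_const]
        _ ≤ _ := by
            refine add_le_add ?_ le_rfl
            exact (mul_le_mul_right hp (n * a)).trans (mul_one _).le
    have h3 : convPow F (n + 1) = (convPow F n).conv (F.restrict (Iic z)) +
        (convPow F n).conv (F.restrict (Ioi z)) := by
      rw [← Measure.conv_add, ← hsplit]; rfl
    rw [h3, Measure.add_apply]
    refine (add_le_add h2 h1).trans (le_of_eq ?_)
    push_cast
    ring

theorem lintegral_exp_convPow (F : Measure ℝ) [IsFiniteMeasure F] (l : ℝ) (n : ℕ) :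
    ∫⁻ s, ENNReal.ofReal (Real.exp (l * s)) ∂(convPow F n) =
      (∫⁻ s, ENNReal.ofReal (Real.exp (l * s)) ∂F) ^ n := by
  induction n with
  | zero => simp [convPow]
  | succ n ih =>
    have hm : Measurable fun s : ℝ => ENNReal.ofReal (Real.exp (l * s)) := by fun_prop
    change ∫⁻ s, ENNReal.ofReal (Real.exp (l * s)) ∂((convPow F n).conv F) = _
    rw [Measure.lintegral_conv hm, pow_succ, ← ih, ← lintegral_mul_const _ hm]
    refine lintegral_congr fun x => ?_
    rw [← lintegral_const_mul _ hm]
    refine lintegral_congr fun y => ?_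
    rw [mul_add, Real.exp_add, ENNReal.ofReal_mul (Real.exp_pos _).le]

/-- On `(0, z]` one has `exp(ls) ≤ 1 + l s exp(lz)`, and on `(-∞, 0]` the exponential is at most
`1`. Hence only the positive part of the truncated mean enters, and `1 + c j ≤ exp(c j)` yields a
form suited to `n`-th powers. -/
theorem lintegral_exp_restrict_Iic_le (F : Measure ℝ) [IsProbabilityMeasure F] {l z j : ℝ}
    (hl : 0 ≤ l) (hj : 0 ≤ j)
    (hJ : ∫⁻ s in Ioc 0 z, ENNReal.ofReal s ∂F ≤ ENNReal.ofReal j) :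
    ∫⁻ s, ENNReal.ofReal (Real.exp (l * s)) ∂(F.restrict (Iic z)) ≤
      ENNReal.ofReal (Real.exp (l * Real.exp (l * z) * j)) := by
  set c := l * Real.exp (l * z) with hc
  have hc0 : 0 ≤ c := by positivity
  have hpt : ∀ s ∈ Iic z, ENNReal.ofReal (Real.exp (l * s)) ≤
      1 + (Ioc 0 z).indicator (fun s => ENNReal.ofReal c * ENNReal.ofReal s) s := by
    intro s hs
    rcases le_or_gt s 0 with h0 | h0
    · have : Real.exp (l * s) ≤ 1 := Real.exp_le_one_iff.2 (mul_nonpos_of_nonneg_of_nonpos hl h0)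
      exact (ENNReal.ofReal_le_one.2 this).trans le_self_add
    · have hs' : s ∈ Ioc 0 z := ⟨h0, hs⟩
      rw [indicator_of_mem hs', ← ENNReal.ofReal_mul hc0,
        ← ENNReal.ofReal_one, ← ENNReal.ofReal_add zero_le_one (by positivity)]
      apply ENNReal.ofReal_le_ofReal
      have h1 : 1 - l * s ≤ Real.exp (-(l * s)) := by linarith [Real.add_one_le_exp (-(l * s))]
      have h2 : Real.exp (l * s) * Real.exp (-(l * s)) = 1 := by rw [← Real.exp_add]; simp
      have h3 : Real.exp (l * s) ≤ Real.exp (l * z) :=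
        Real.exp_le_exp.2 (mul_le_mul_of_nonneg_left hs hl)
      have h4 : l * s * Real.exp (l * s) ≤ l * s * Real.exp (l * z) := by gcongr
      have h5 := mul_le_mul_of_nonneg_left h1 (Real.exp_pos (l * s)).le
      rw [hc]
      nlinarith
  calc ∫⁻ s, ENNReal.ofReal (Real.exp (l * s)) ∂(F.restrict (Iic z))
      ≤ ∫⁻ s in Iic z, (1 + (Ioc 0 z).indicator
          (fun s => ENNReal.ofReal c * ENNReal.ofReal s) s) ∂F :=
        setLIntegral_mono' measurableSet_Iic hpt
    _ ≤ ∫⁻ s, (1 + (Ioc 0 z).indicator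
          (fun s => ENNReal.ofReal c * ENNReal.ofReal s) s) ∂F := setLIntegral_le_lintegral _ _
    _ = 1 + ENNReal.ofReal c * ∫⁻ s in Ioc 0 z, ENNReal.ofReal s ∂F := by
        rw [lintegral_add_left measurable_const, lintegral_indicator measurableSet_Ioc,
          lintegral_const_mul _ ENNReal.measurable_ofReal]
        simp
    _ ≤ 1 + ENNReal.ofReal c * ENNReal.ofReal j := by gcongr
    _ = ENNReal.ofReal (1 + c * j) := by
        rw [ENNReal.ofReal_add zero_le_one (by positivity), ENNReal.ofReal_one,
          ENNReal.ofReal_mul hc0]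
    _ ≤ _ := ENNReal.ofReal_le_ofReal (by linarith [Real.add_one_le_exp (c * j)])

/-- Chernoff bound for convolution powers of a distribution truncated at `z`. -/
theorem convPow_restrict_Iic_Ioc_le (F : Measure ℝ) [IsProbabilityMeasure F] {l z j : ℝ}
    (hl : 0 ≤ l) (hj : 0 ≤ j)
    (hJ : ∫⁻ s in Ioc 0 z, ENNReal.ofReal s ∂F ≤ ENNReal.ofReal j) (n : ℕ) (t h : ℝ) :
    convPow (F.restrict (Iic z)) n (Ioc t (t + h)) ≤
      ENNReal.ofReal (Real.exp (n * (l * Real.exp (l * z) * j) - l * t)) := by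
  have h1 : convPow (F.restrict (Iic z)) n (Ioc t (t + h)) ≤
      ∫⁻ s, ENNReal.ofReal (Real.exp (-(l * t))) * ENNReal.ofReal (Real.exp (l * s))
        ∂(convPow (F.restrict (Iic z)) n) := by
    rw [← lintegral_indicator_one measurableSet_Ioc]
    refine lintegral_mono fun s => ?_
    by_cases hs : s ∈ Ioc t (t + h)
    · simp only [indicator_of_mem hs, Pi.one_apply]
      rw [← ENNReal.ofReal_mul (Real.exp_pos _).le, ← Real.exp_add, ENNReal.one_le_ofReal]
      apply Real.one_le_exp
      nlinarith [hs.1]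
    · simp [indicator_of_notMem hs]
  refine h1.trans ?_
  rw [lintegral_const_mul _ (by fun_prop), lintegral_exp_convPow]
  refine (mul_le_mul_right (pow_le_pow_left' (lintegral_exp_restrict_Iic_le F hl hj hJ) n)
    _).trans (le_of_eq ?_)
  rw [← ENNReal.ofReal_pow (Real.exp_pos _).le, ← Real.exp_nat_mul,
    ← ENNReal.ofReal_mul (Real.exp_pos _).le, ← Real.exp_add]
  congr 2
  ring

/-! ### Potter-type bounds from doubling ratios. -/

theorem dyadic_induction {P : ℝ → Prop} {x₀ : ℝ} (h0 : 0 < x₀)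
    (base : ∀ x ∈ Icc x₀ (2 * x₀), P x) (step : ∀ x, x₀ ≤ x → P x → P (2 * x)) :
    ∀ x, x₀ ≤ x → P x := by
  have key : ∀ k : ℕ, ∀ x ∈ Icc x₀ (2 ^ k * (2 * x₀)), P x := by
    intro k
    induction k with
    | zero => simpa using base
    | succ k ih =>
      rintro x ⟨h1, h2⟩
      rcases le_or_gt x (2 * x₀) with h3 | h3
      · exact base x ⟨h1, h3⟩
      · have := step (x / 2) (by linarith) (ih (x / 2) ⟨by linarith, by
          rw [pow_succ] at h2; linarith⟩)
        rwa [mul_div_cancel₀ _ two_ne_zero] at this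
  intro x hx
  obtain ⟨k, hk⟩ := pow_unbounded_of_one_lt (x / (2 * x₀)) one_lt_two
  exact key k x ⟨hx, ((div_lt_iff₀ (by positivity)).1 hk).le⟩

/-- Upper Potter bound for monotone functions. -/
theorem MonotoneOn.exists_potter_upper {f : ℝ → ℝ} (hmono : MonotoneOn f (Ioi 0))
    (hpos : ∀ x, 0 < x → 0 < f x) {ρ σ : ℝ} (hσ0 : 0 ≤ σ) (hσ : ρ < σ)
    (hlim : Tendsto (fun x => f (2 * x) / f x) atTop (𝓝 (2 ^ ρ))) :
    ∃ x₀, 0 < x₀ ∧ ∀ x, x₀ ≤ x → ∀ y, x ≤ y → f y ≤ 2 ^ σ * (y / x) ^ σ * f x := by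
  have hlt : (2 : ℝ) ^ ρ < 2 ^ σ := Real.rpow_lt_rpow_of_exponent_lt one_lt_two hσ
  obtain ⟨x₁, hx₁⟩ := eventually_atTop.1 (hlim.eventually_le_const hlt)
  refine ⟨max x₁ 1, by positivity, fun x hx => ?_⟩
  have hx0 : 0 < x := lt_of_lt_of_le one_pos ((le_max_right _ _).trans hx)
  have hdbl : ∀ y, x ≤ y → f (2 * y) ≤ 2 ^ σ * f y := fun y hy =>
    (div_le_iff₀ (hpos y (hx0.trans_le hy))).1 (hx₁ y ((le_max_left _ _).trans (hx.trans hy)))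
  refine dyadic_induction hx0 ?_ ?_
  -- Monotonicity controls `f` within one dyadic block, at the price of the constant factor `2 ^ σ`;
  -- so the limit along the ratio `2` alone suffices.
  · rintro y ⟨h1, h2⟩
    have h3 : 1 ≤ (y / x) ^ σ := Real.one_le_rpow ((one_le_div hx0).2 h1) hσ0
    have h4 : f y ≤ f (2 * x) := hmono (hx0.trans_le h1) (by simpa using hx0) h2
    have h5 : 0 ≤ (2 : ℝ) ^ σ * f x := mul_nonneg (by positivity) (hpos x hx0).le
    nlinarith [hdbl x le_rfl]
  · intro y hy ih
    have hy0 := hx0.trans_le hy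
    have h1 : (2 * y / x) ^ σ = 2 ^ σ * (y / x) ^ σ := by
      rw [mul_div_assoc, Real.mul_rpow (by norm_num) (by positivity)]
    rw [h1]
    refine (hdbl y hy).trans ?_
    calc 2 ^ σ * f y ≤ 2 ^ σ * (2 ^ σ * (y / x) ^ σ * f x) := by gcongr
      _ = _ := by ring

theorem Antitone.exists_le_rpow {f : ℝ → ℝ} (hanti : Antitone f)
    (hpos : ∀ x, 0 < f x) {ρ σ : ℝ} (hσ0 : σ ≤ 0) (hσ : ρ < σ)
    (hlim : Tendsto (fun x => f (2 * x) / f x) atTop (𝓝 (2 ^ ρ))) :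
    ∃ C, 0 < C ∧ ∀ᶠ x in atTop, f x ≤ C * x ^ σ := by
  have hlt : (2 : ℝ) ^ ρ < 2 ^ σ := Real.rpow_lt_rpow_of_exponent_lt one_lt_two hσ
  obtain ⟨x₁, hx₁⟩ := eventually_atTop.1 (hlim.eventually_le_const hlt)
  set x₀ := max x₁ 1
  have hx0 : 0 < x₀ := by positivity
  have hD : 0 < (2 * x₀) ^ σ := by positivity
  refine ⟨f x₀ / (2 * x₀) ^ σ, div_pos (hpos _) hD, ?_⟩
  filter_upwards [eventually_ge_atTop x₀]
  refine dyadic_induction hx0 ?_ ?_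
  · rintro y ⟨h1, h2⟩
    have h3 : (2 * x₀) ^ σ ≤ y ^ σ :=
      Real.rpow_le_rpow_of_nonpos (hx0.trans_le h1) h2 hσ0
    calc f y ≤ f x₀ := hanti h1
      _ = f x₀ / (2 * x₀) ^ σ * (2 * x₀) ^ σ := by field_simp
      _ ≤ _ := by
        have := (div_pos (hpos x₀) hD).le
        gcongr
  · intro y hy ih
    have hy0 := hx0.trans_le hy
    have h1 := (div_le_iff₀ (hpos y)).1 (hx₁ y ((le_max_left _ _).trans hy))
    rw [Real.mul_rpow (by norm_num) hy0.le]
    refine h1.trans ?_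
    calc 2 ^ σ * f y ≤ 2 ^ σ * (f x₀ / (2 * x₀) ^ σ * y ^ σ) := by gcongr
      _ = _ := by ring

/-! ### The tail of `F` and its truncated mean. -/

theorem antitone_tailFn (F : Measure ℝ) : Antitone (tailFn F) := fun _ _ h =>
  sub_le_sub_left (monotone_cdf F h) 1

theorem measureReal_Ioc_eq_tailFn_sub (F : Measure ℝ) [IsProbabilityMeasure F] {x y : ℝ}
    (h : x ≤ y) : F.real (Ioc x y) = tailFn F x - tailFn F y := by
  simp only [tailFn, cdf_eq_real]
  rw [← Iic_sdiff_Iic, measureReal_sdiff (Iic_subset_Iic.2 h) measurableSet_Iic]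
  ring

/-- Karamata-type bound for the truncated mean. -/
theorem exists_lintegral_Ioc_le_mul_tailFn (F : Measure ℝ) [IsProbabilityMeasure F] {α : ℝ}
    (hα : α < 1) (hpos : ∀ x, 0 < tailFn F x)
    (hlim : Tendsto (fun x => tailFn F (2 * x) / tailFn F x) atTop (𝓝 (2 ^ (-α)))) :
    ∃ C, 0 < C ∧ ∀ᶠ x in atTop,
      ∫⁻ s in Ioc 0 x, ENNReal.ofReal s ∂F ≤ ENNReal.ofReal (C * (x * tailFn F x)) := by
  -- Since `α < 1`, eventually `T(2x) ≥ q T(x)` with `2q > 1`, so `x T(x)` grows by a factor at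
  -- least `2q` under doubling, while the truncated mean grows by at most `2x T(x)`.
  obtain ⟨q, hq1, hq2⟩ : ∃ q : ℝ, 1 / 2 < q ∧ q < 2 ^ (-α) := by
    apply exists_between
    have := Real.rpow_lt_rpow_of_exponent_lt one_lt_two (show (-1 : ℝ) < -α by linarith)
    rwa [Real.rpow_neg_one, ← one_div] at this
  obtain ⟨x₁, hx₁⟩ := eventually_atTop.1 (hlim.eventually_const_le hq2)
  set x₀ := max x₁ 1
  have hx0 : 0 < x₀ := by positivity
  -- The first entry serves the base block; the second gives `C + 2 ≤ 2qC`, which closes the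
  -- doubling step.
  set C := max (2 / tailFn F (2 * x₀)) (2 / (2 * q - 1)) with hC
  have hC0 : 0 < C := lt_max_of_lt_left (div_pos two_pos (hpos _))
  have hC1 : 2 ≤ C * tailFn F (2 * x₀) := (div_le_iff₀ (hpos _)).1 (le_max_left _ _)
  have hC2 : 2 ≤ C * (2 * q - 1) := (div_le_iff₀ (by linarith)).1 (le_max_right _ _)
  refine ⟨C, hC0, ?_⟩
  have hIoc : ∀ a b : ℝ, 0 ≤ b → ∫⁻ s in Ioc a b, ENNReal.ofReal s ∂F ≤
      ENNReal.ofReal (b * F.real (Ioc a b)) := by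
    intro a b hb
    rw [ENNReal.ofReal_mul hb, ofReal_measureReal, ← setLIntegral_const]
    exact setLIntegral_mono' measurableSet_Ioc fun s hs => ENNReal.ofReal_le_ofReal hs.2
  filter_upwards [eventually_ge_atTop x₀]
  refine dyadic_induction hx0 ?_ ?_
  · rintro x ⟨h1, h2⟩
    have hx := hx0.trans_le h1
    refine (hIoc 0 x hx.le).trans (ENNReal.ofReal_le_ofReal ?_)
    have h3 : F.real (Ioc 0 x) ≤ 1 := measureReal_le_one
    have h4 : C * tailFn F (2 * x₀) ≤ C * tailFn F x :=
      mul_le_mul_of_nonneg_left (antitone_tailFn F h2) hC0.le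
    nlinarith
  · intro x hx ih
    have hx' := hx0.trans_le hx
    have hT := (le_div_iff₀ (hpos x)).1 (hx₁ x ((le_max_left _ _).trans hx))
    have h1 : F.real (Ioc x (2 * x)) ≤ tailFn F x := by
      rw [measureReal_Ioc_eq_tailFn_sub F (by linarith)]
      linarith [hpos (2 * x)]
    have hxT := mul_pos hx' (hpos x)
    rw [← Ioc_union_Ioc_eq_Ioc hx'.le (by linarith : x ≤ 2 * x)]
    refine (lintegral_union_le _ _ _).trans ((add_le_add ih (hIoc x (2 * x) (by linarith))).trans ?_)
    rw [← ENNReal.ofReal_add (by positivity) (by positivity)]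
    apply ENNReal.ofReal_le_ofReal
    have h2 : 2 * x * F.real (Ioc x (2 * x)) ≤ 2 * x * tailFn F x := by gcongr
    have h3 : C * (2 * x) * (q * tailFn F x) ≤ C * (2 * x) * tailFn F (2 * x) := by gcongr
    have h4 := mul_le_mul_of_nonneg_right hC2 hxT.le
    nlinarith

/-! ### The cutoff criterion for a general truncation level. -/

theorem sum_range_ceil_le_sq (L : ℝ) :
    ∑ n ∈ Finset.range ⌈L⌉₊, (n : ℝ) ≤ L ^ 2 := by
  rcases Nat.lt_or_ge ⌈L⌉₊ 2 with h | h
  · interval_cases ⌈L⌉₊ <;> simp <;> positivity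
  · obtain ⟨m, hm⟩ : ∃ m, ⌈L⌉₊ = m + 1 := ⟨⌈L⌉₊ - 1, by omega⟩
    have hmL : (m : ℝ) < L := Nat.lt_ceil.1 (by omega)
    have h1 : (1 : ℝ) ≤ m := by exact_mod_cast (by omega : 1 ≤ m)
    have h2 : (∑ n ∈ Finset.range (m + 1), (n : ℝ)) * 2 = (m + 1) * m := by
      have := congrArg (Nat.cast : ℕ → ℝ) (Finset.sum_range_id_mul_two (m + 1))
      rw [Nat.add_sub_cancel] at this
      push_cast at this
      exact this
    rw [hm]
    nlinarith

/-- Joins the big-step and Chernoff bounds. The factor `n` on `r` is wasteful for `n ≥ 1` but makes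
the bound vanish at `n = 0`, where the unit mass at `0` misses every window to the right of `y > 0`;
the sum over `n < L` is then at most `L² (a + r)`, even for small `L`. -/
theorem iSup_convPow_Ioc_le (F : Measure ℝ) [IsProbabilityMeasure F] {h z l j a r y : ℝ}
    (hy : 0 < y) (hl : 0 ≤ l) (hj : 0 ≤ j) (ha : 0 ≤ a)
    (hJ : ∫⁻ s in Ioc 0 z, ENNReal.ofReal s ∂F ≤ ENNReal.ofReal j)
    (hsup : ∀ u, z ≤ u + h → F.real (Ioc u (u + h)) ≤ a) (n : ℕ)
    (hr : Real.exp (n * (l * Real.exp (l * z) * j) - l * y) ≤ r) :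
    ⨆ t ∈ Ici y, convPow F n (Ioc t (t + h)) ≤ ENNReal.ofReal (n * (a + r)) := by
  have hr0 : 0 < r := (Real.exp_pos _).trans_le hr
  refine iSup₂_le fun t ht => ?_
  rcases Nat.eq_zero_or_pos n with rfl | hn
  · have : (0 : ℝ) ∉ Ioc t (t + h) := fun h0 => by linarith [h0.1, mem_Ici.1 ht]
    simp [convPow, this]
  have hn1 : (1 : ℝ) ≤ n := by exact_mod_cast hn
  have ha' : ∀ u, F.restrict (Ioi z) (Ioc u (u + h)) ≤ ENNReal.ofReal a := by
    intro u
    rcases le_or_gt z (u + h) with hu | hu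
    · refine (Measure.restrict_apply_le _ _).trans ?_
      rw [← ofReal_measureReal]
      exact ENNReal.ofReal_le_ofReal (hsup u hu)
    · rw [Measure.restrict_apply measurableSet_Ioc]
      have : Ioc u (u + h) ∩ Ioi z = ∅ := by
        ext s
        simp only [mem_inter_iff, mem_Ioc, mem_Ioi, mem_empty_iff_false, iff_false]
        rintro ⟨⟨_, h2⟩, h3⟩
        linarith
      simp [this]
  calc convPow F n (Ioc t (t + h))
      ≤ n * ENNReal.ofReal a + convPow (F.restrict (Iic z)) n (Ioc t (t + h)) :=
        convPow_Ioc_le_truncated F h z _ ha' n t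
    _ ≤ n * ENNReal.ofReal a +
          ENNReal.ofReal (Real.exp (n * (l * Real.exp (l * z) * j) - l * t)) := by
        gcongr
        exact convPow_restrict_Iic_Ioc_le F hl hj hJ n t h
    _ = ENNReal.ofReal (n * a + Real.exp (n * (l * Real.exp (l * z) * j) - l * t)) := by
        rw [ENNReal.ofReal_add (by positivity) (Real.exp_pos _).le,
          ENNReal.ofReal_mul (by positivity), ENNReal.ofReal_natCast]
    _ ≤ _ := by
        apply ENNReal.ofReal_le_ofReal
        have h1 : Real.exp (n * (l * Real.exp (l * z) * j) - l * t) ≤ r :=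
          (Real.exp_le_exp.2 (by
            have := mul_le_mul_of_nonneg_left (mem_Ici.1 ht) hl
            linarith)).trans hr
        nlinarith

/-- Sufficient condition for the uniform cutoff property in terms of a truncation level `z`. -/
theorem uniformCutoff_of_truncation (F : Measure ℝ) [IsProbabilityMeasure F] {h α C₁ θ : ℝ}
    (hα : α < 1) {A M L z : ℝ → ℝ} (hθ : 0 < θ) (hA : ∀ x, 0 < x → 0 < A x)
    (hTpos : ∀ x, 0 < tailFn F x)
    (hAT : Tendsto (fun x => tailFn F x * A x) atTop (𝓝 1))
    (hT2 : Tendsto (fun x => tailFn F (2 * x) / tailFn F x) atTop (𝓝 (2 ^ (-α))))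
    (hTinv : ∃ C, ∀ᶠ x in atTop, 1 / tailFn F x ≤ C * x)
    (hM : ∀ x, 0 < x → 0 < M x) (hMmono : MonotoneOn M (Ioi 0))
    (hC₁ : 0 < C₁)
    (hloc : ∀ᶠ x in atTop, F.real (Ioc x (x + h)) ≤ C₁ * (tailFn F x / M x))
    (hz : Tendsto z atTop atTop) (hzx : ∀ᶠ x in atTop, z x ≤ x)
    (hL : ∀ x, 0 < x → 0 < L x)
    (h1 : Tendsto (fun x => L x ^ 2 * (x * tailFn F x) * (tailFn F (z x / 2) / M (z x / 2)))
      atTop (𝓝 0))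
    (h2 : Tendsto (fun x => L x * tailFn F x * Real.exp (6 / θ * Real.log x / x * z x))
      atTop (𝓝 0)) :
    UniformCutoff F A h θ L := by
  set T := tailFn F with hT
  obtain ⟨CJ, hCJ, hJ⟩ := exists_lintegral_Ioc_le_mul_tailFn F hα hTpos hT2
  obtain ⟨Cinv, hTinv⟩ := hTinv
  obtain ⟨x₁, hx₁⟩ := eventually_atTop.1 hloc
  have hbound : ∀ᶠ x in atTop, ENNReal.ofReal (x / A x) *
      ∑ n ∈ Finset.range ⌈L x⌉₊, ⨆ t ∈ Ici (θ * x), convPow F n (Ioc t (t + h)) ≤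
      ENNReal.ofReal (x / A x * (L x ^ 2 *
        (C₁ * (T (z x / 2) / M (z x / 2)) + x ^ (-3 : ℝ)))) := by
    have hsmall := h2.eventually_le_const (show 0 < θ / (2 * CJ) by positivity)
    filter_upwards [hJ, hzx, hsmall, hz.eventually_ge_atTop (2 * h), hz.eventually_ge_atTop 1,
      hz.eventually_ge_atTop (2 * x₁), eventually_ge_atTop 1] with x hJx hzx hs hzh hz1 hzx₁ hx1
    have hx0 : 0 < x := by linarith
    have hlog : 0 ≤ Real.log x := Real.log_nonneg hx1
    have hA0 := hA x hx0
    have hT0 := hTpos x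
    have hz2 : 0 < z x / 2 := by linarith
    have hM2 := hM _ hz2
    have hTz := hTpos (z x / 2)
    set a := C₁ * (T (z x / 2) / M (z x / 2)) with ha
    have ha0 : 0 ≤ a := by positivity
    have hsup : ∀ u, z x ≤ u + h → F.real (Ioc u (u + h)) ≤ a := by
      intro u hu
      -- A window reaching level `z x` starts at `z x - h` or later, hence beyond `z x / 2` because
      -- `z x ≥ 2 * h`.
      have hu2 : z x / 2 ≤ u := by linarith
      refine (hx₁ u (by linarith)).trans ?_
      rw [ha]
      have h3 := antitone_tailFn F hu2
      have h4 : M (z x / 2) ≤ M u := hMmono hz2 (hz2.trans_le hu2) hu2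
      gcongr
    have hterm : ∀ n ∈ Finset.range ⌈L x⌉₊, ⨆ t ∈ Ici (θ * x), convPow F n (Ioc t (t + h)) ≤
        ENNReal.ofReal (n * (a + x ^ (-3 : ℝ))) := by
      intro n hn
      have hnL : (n : ℝ) ≤ L x := (Nat.lt_ceil.1 (Finset.mem_range.1 hn)).le
      -- With this `l`, the term `l * θ * x` equals `6 log x`, and the threshold `θ / (2 * CJ)`
      -- keeps the exponential-moment term below `3 log x`; the difference gives `x ^ (-3)`.
      refine iSup_convPow_Ioc_le F (z := z x) (l := 6 / θ * Real.log x / x)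
        (j := CJ * (x * T x)) (by positivity) (by positivity) (by positivity) ha0
        ((lintegral_mono_set (Ioc_subset_Ioc_right hzx)).trans hJx) hsup n ?_
      rw [Real.rpow_def_of_pos hx0]
      apply Real.exp_le_exp.2
      have h3 : (n : ℝ) * T x * Real.exp (6 / θ * Real.log x / x * z x) ≤ θ / (2 * CJ) := by
        refine le_trans ?_ hs
        gcongr
      have h4 : (n : ℝ) * (6 / θ * Real.log x / x * Real.exp (6 / θ * Real.log x / x * z x) *
          (CJ * (x * T x))) = (n : ℝ) * T x * Real.exp (6 / θ * Real.log x / x * z x) *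
          (6 / θ * Real.log x * CJ) := by
        field_simp
      have h5 := mul_le_mul_of_nonneg_right h3
        (show 0 ≤ 6 / θ * Real.log x * CJ by positivity)
      have h6 : θ / (2 * CJ) * (6 / θ * Real.log x * CJ) = 3 * Real.log x := by
        field_simp; ring
      have h7 : 6 / θ * Real.log x / x * (θ * x) = 6 * Real.log x := by field_simp
      rw [h4, h7]
      linarith
    have hx3 : 0 ≤ x ^ (-3 : ℝ) := by positivity
    rw [ENNReal.ofReal_mul (by positivity)]
    refine mul_le_mul_right ((Finset.sum_le_sum hterm).trans ?_) _
    rw [← ENNReal.ofReal_sum_of_nonneg fun n _ => by positivity, ← Finset.sum_mul]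
    exact ENNReal.ofReal_le_ofReal
      (mul_le_mul_of_nonneg_right (sum_range_ceil_le_sq _) (by positivity))
  have hLT : Tendsto (fun x => L x * T x) atTop (𝓝 0) := by
    refine squeeze_zero' ?_ ?_ h2
    · filter_upwards [eventually_gt_atTop 0] with x hx
      exact mul_nonneg (hL x hx).le (hTpos x).le
    · filter_upwards [eventually_ge_atTop 1, hz.eventually_ge_atTop 0] with x hx hzx
      have hx0 : 0 < x := by linarith
      have hlog : 0 ≤ Real.log x := Real.log_nonneg hx
      exact le_mul_of_one_le_right (mul_nonneg (hL x hx0).le (hTpos x).le)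
        (Real.one_le_exp (by positivity))
  -- Disposes of the `x ^ (-3)` term: `x T · L² · x⁻³ = (L T)² · (1 / T) · x⁻²`.
  have hTx : Tendsto (fun x => 1 / T x * x ^ (-2 : ℝ)) atTop (𝓝 0) := by
    have h3 : Tendsto (fun x : ℝ => Cinv * x⁻¹) atTop (𝓝 0) := by
      simpa using tendsto_inv_atTop_zero.const_mul Cinv
    refine squeeze_zero' ?_ ?_ h3
    · filter_upwards [eventually_gt_atTop 0] with x hx
      have := hTpos x
      positivity
    · filter_upwards [eventually_gt_atTop 0, hTinv] with x hx hi
      have h4 : x ^ (-2 : ℝ) = x⁻¹ * x⁻¹ := by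
        rw [show (-2 : ℝ) = -1 + -1 by norm_num, Real.rpow_add hx, Real.rpow_neg_one]
      rw [h4]
      have h5 : 0 ≤ x⁻¹ * x⁻¹ := by positivity
      calc 1 / T x * (x⁻¹ * x⁻¹) ≤ Cinv * x * (x⁻¹ * x⁻¹) := by gcongr
        _ = Cinv * x⁻¹ := by field_simp
  have hreal : Tendsto (fun x => x / A x * (L x ^ 2 *
      (C₁ * (T (z x / 2) / M (z x / 2)) + x ^ (-3 : ℝ)))) atTop (𝓝 0) := by
    have h3 := (hAT.inv₀ one_ne_zero).mul
      ((h1.const_mul C₁).add ((hLT.mul hLT).mul hTx))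
    simp only [mul_zero, add_zero] at h3
    refine h3.congr' ?_
    filter_upwards [eventually_gt_atTop 0] with x hx
    have hA0 := (hA x hx).ne'
    have hT0 := (hTpos x).ne'
    have h4 : x ^ (-2 : ℝ) = x * x ^ (-3 : ℝ) := by
      rw [show (-2 : ℝ) = 1 + -3 by norm_num, Real.rpow_add hx, Real.rpow_one]
    rw [h4]
    field_simp
  apply Tendsto.limsup_eq
  have h5 := ENNReal.tendsto_ofReal hreal
  rw [ENNReal.ofReal_zero] at h5
  exact tendsto_of_tendsto_of_tendsto_of_le_of_le' tendsto_const_nhds h5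
    (Eventually.of_forall fun _ => zero_le) hbound

/-! ### Consequences of the hypotheses on `F`, `A` and `M`. -/

theorem tendsto_mul_of_isEquivalent_one_div {T A : ℝ → ℝ} (hA : ∀ x, 0 < x → 0 < A x)
    (hF : T ~[atTop] fun x => 1 / A x) : Tendsto (fun x => T x * A x) atTop (𝓝 1) := by
  have hne : ∀ᶠ x in atTop, (fun x => 1 / A x) x ≠ 0 := by
    filter_upwards [eventually_gt_atTop 0] with x hx
    exact (one_div_pos.2 (hA x hx)).ne'
  refine ((isEquivalent_iff_tendsto_one hne).1 hF).congr fun x => ?_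
  simp

theorem tailFn_pos_of_tendsto_mul (F : Measure ℝ) {A : ℝ → ℝ} (hA : ∀ x, 0 < x → 0 < A x)
    (hAT : Tendsto (fun x => tailFn F x * A x) atTop (𝓝 1)) (x : ℝ) : 0 < tailFn F x := by
  obtain ⟨y, hy, hy0, hxy⟩ := ((hAT.eventually_const_lt one_pos).and
    ((eventually_gt_atTop 0).and (eventually_ge_atTop x))).exists
  exact (pos_of_mul_pos_left hy (hA y hy0).le).trans_le (antitone_tailFn F hxy)

theorem tendsto_ratio_two_of_tendsto_mul {T A : ℝ → ℝ} {α : ℝ} (hA : IsRegVar α A)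
    (hAT : Tendsto (fun x => T x * A x) atTop (𝓝 1)) :
    Tendsto (fun x => T (2 * x) / T x) atTop (𝓝 (2 ^ (-α))) := by
  have h2 : Tendsto (fun x : ℝ => 2 * x) atTop atTop := tendsto_id.const_mul_atTop two_pos
  have h3 := ((hAT.comp h2).div hAT one_ne_zero).mul
    ((hA.tendsto 2 two_pos).inv₀ (by positivity))
  rw [div_one, one_mul, ← Real.rpow_neg two_pos.le] at h3
  refine h3.congr' ?_
  filter_upwards [eventually_gt_atTop 0] with x hx
  have h4 := (hA.pos x hx).ne'
  have h5 := (hA.pos (2 * x) (by positivity)).ne'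
  simp only [Pi.div_apply, Function.comp_apply]
  field_simp

theorem exists_local_bound_of_omegaFn (F : Measure ℝ) {h : ℝ} {M : ℝ → ℝ}
    (hTpos : ∀ x, 0 < tailFn F x) (hM : ∀ x, 0 < x → 0 < M x)
    (hω : omegaFn F h =O[atTop] fun x => x / M x) :
    ∃ C, 0 < C ∧ ∀ᶠ x in atTop, F.real (Ioc x (x + h)) ≤ C * (tailFn F x / M x) := by
  obtain ⟨C, hC, hb⟩ := hω.exists_pos
  refine ⟨C, hC, ?_⟩
  filter_upwards [hb.bound, eventually_gt_atTop 0] with x hx hx0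
  have hT := hTpos x
  have hMx := hM x hx0
  rw [Real.norm_of_nonneg (show 0 ≤ x / M x by positivity)] at hx
  have h1 := (le_abs_self _).trans hx
  rw [omegaFn, div_le_iff₀ hT] at h1
  refine le_of_mul_le_mul_left (h1.trans (le_of_eq ?_)) hx0
  field_simp

/-- A local tail bound with denominator `M` forces `M` to grow at most linearly. -/
theorem exists_le_mul_of_local_bound (F : Measure ℝ) [IsProbabilityMeasure F] {α h C₁ : ℝ}
    {M : ℝ → ℝ} (hα : 0 < α) (hh : 0 < h) (hC₁ : 0 < C₁) (hTpos : ∀ x, 0 < tailFn F x)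
    (hT2 : Tendsto (fun x => tailFn F (2 * x) / tailFn F x) atTop (𝓝 (2 ^ (-α))))
    (hM : ∀ x, 0 < x → 0 < M x) (hMmono : MonotoneOn M (Ioi 0))
    (hloc : ∀ᶠ x in atTop, F.real (Ioc x (x + h)) ≤ C₁ * (tailFn F x / M x)) :
    ∃ C, 0 < C ∧ ∀ᶠ x in atTop, M x ≤ C * x := by
  obtain ⟨q, hq1, hq2⟩ : ∃ q : ℝ, 2 ^ (-α) < q ∧ q < 1 :=
    exists_between (Real.rpow_lt_one_of_one_lt_of_neg one_lt_two (neg_lt_zero.2 hα))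
  obtain ⟨x₁, hx₁⟩ := eventually_atTop.1 hloc
  have hq : 0 < 1 - q := by linarith
  refine ⟨(1 / h + 1) * C₁ / (1 - q), by positivity, ?_⟩
  filter_upwards [hT2.eventually_le_const hq1, eventually_ge_atTop x₁, eventually_ge_atTop 1]
    with x hxq hxx₁ hx1
  have hx0 : 0 < x := by linarith
  have hT := hTpos x
  have hMx := hM x hx0
  -- The interval `(x, 2x]` carries at least the fraction `1 - q` of the tail at `x`, yet it is
  -- covered by `⌈x / h⌉₊` windows, each of mass at most `C₁ * T(x) / M(x)`.
  have hk : ∀ k : ℕ, tailFn F x - tailFn F (x + k * h) ≤ k * (C₁ * (tailFn F x / M x)) := by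
    intro k
    induction k with
    | zero => simp
    | succ k ih =>
      have hkh : 0 ≤ (k : ℝ) * h := by positivity
      have h1 := hx₁ (x + k * h) (by linarith)
      rw [measureReal_Ioc_eq_tailFn_sub F (by linarith)] at h1
      have h2 : C₁ * (tailFn F (x + k * h) / M (x + k * h)) ≤ C₁ * (tailFn F x / M x) := by
        have h3 : tailFn F (x + k * h) ≤ tailFn F x := antitone_tailFn F (by linarith)
        have h4 : M x ≤ M (x + k * h) :=
          hMmono hx0 (show 0 < x + k * h by linarith) (by linarith)
        gcongr
      have h5 : x + (k + 1 : ℕ) * h = x + k * h + h := by push_cast; ring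
      rw [h5]
      push_cast
      linarith
  have h1 := hk ⌈x / h⌉₊
  have h2 : (⌈x / h⌉₊ : ℝ) ≤ x / h + 1 := (Nat.ceil_lt_add_one (by positivity)).le
  have h3 : x ≤ ⌈x / h⌉₊ * h := (div_le_iff₀ hh).1 (Nat.le_ceil _)
  have h4 : tailFn F (x + ⌈x / h⌉₊ * h) ≤ tailFn F (2 * x) := antitone_tailFn F (by linarith)
  have h5 := (div_le_iff₀ hT).1 hxq
  have h6 : (⌈x / h⌉₊ : ℝ) * (C₁ * (tailFn F x / M x)) ≤
      ((1 / h + 1) * x) * (C₁ * (tailFn F x / M x)) := by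
    have : x / h + 1 ≤ (1 / h + 1) * x := by
      rw [add_mul, one_div_mul_eq_div]; linarith
    gcongr
    exact h2.trans this
  have h7 : (1 - q) * tailFn F x ≤ ((1 / h + 1) * x) * (C₁ * (tailFn F x / M x)) := by linarith
  rw [div_mul_eq_mul_div, le_div_iff₀ hq]
  have h8 := mul_le_mul_of_nonneg_right h7 (div_pos hMx hT).le
  have h9 : (1 - q) * tailFn F x * (M x / tailFn F x) = M x * (1 - q) := by field_simp
  have h10 : ((1 / h + 1) * x) * (C₁ * (tailFn F x / M x)) * (M x / tailFn F x) =
      (1 / h + 1) * C₁ * x := by field_simp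
  rw [h9, h10] at h8
  exact h8

theorem exists_one_div_tailFn_le (F : Measure ℝ) {α : ℝ} (hα : α < 1)
    (hTpos : ∀ x, 0 < tailFn F x)
    (hT2 : Tendsto (fun x => tailFn F (2 * x) / tailFn F x) atTop (𝓝 (2 ^ (-α)))) :
    ∃ C, ∀ᶠ x in atTop, 1 / tailFn F x ≤ C * x := by
  have hlim : Tendsto (fun x => (1 / tailFn F (2 * x)) / (1 / tailFn F x)) atTop (𝓝 (2 ^ α)) := by
    have := hT2.inv₀ (by positivity)
    rw [← Real.rpow_neg two_pos.le, neg_neg] at this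
    exact this.congr fun x => by simp [div_eq_mul_inv, mul_comm]
  obtain ⟨x₀, hx₀, hp⟩ := MonotoneOn.exists_potter_upper (f := fun x => 1 / tailFn F x)
    (fun x _ y _ hxy => one_div_le_one_div_of_le (hTpos y) (antitone_tailFn F hxy))
    (fun x _ => one_div_pos.2 (hTpos x)) zero_le_one hα hlim
  refine ⟨2 / x₀ * (1 / tailFn F x₀), ?_⟩
  filter_upwards [eventually_ge_atTop x₀] with x hx
  refine (hp x₀ le_rfl x hx).trans (le_of_eq ?_)
  simp only [Real.rpow_one]
  ring

/-- Upper Potter bound for the ratio of `M` and the tail of `F`. -/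
theorem exists_potter_div_tailFn (F : Measure ℝ) {α β σ : ℝ} {M : ℝ → ℝ}
    (hTpos : ∀ x, 0 < tailFn F x)
    (hT2 : Tendsto (fun x => tailFn F (2 * x) / tailFn F x) atTop (𝓝 (2 ^ (-α))))
    (hM : IsRegVar β M) (hMmono : MonotoneOn M (Ioi 0)) (hσ0 : 0 ≤ σ) (hσ : α + β < σ) :
    ∃ x₀, 0 < x₀ ∧ ∀ x, x₀ ≤ x → ∀ y, x ≤ y →
      M y / tailFn F y ≤ 2 ^ σ * (y / x) ^ σ * (M x / tailFn F x) := by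
  refine MonotoneOn.exists_potter_upper (f := fun x => M x / tailFn F x) (ρ := α + β) ?_
    (fun x hx => div_pos (hM.pos x hx) (hTpos x)) hσ0 hσ ?_
  · intro x hx y hy hxy
    exact div_le_div₀ (hM.pos y hy).le (hMmono hx hy hxy) (hTpos y) (antitone_tailFn F hxy)
  · have h1 := (hM.tendsto 2 two_pos).mul (hT2.inv₀ (by positivity))
    rw [← Real.rpow_neg two_pos.le, neg_neg, ← Real.rpow_add two_pos, add_comm] at h1
    refine h1.congr fun x => ?_
    simp only [div_eq_mul_inv, mul_inv, inv_inv]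
    ring

theorem tendsto_log_rpow_neg {γ : ℝ} (hγ : 0 < γ) :
    Tendsto (fun x => Real.log x ^ (-γ)) atTop (𝓝 0) :=
  (tendsto_rpow_neg_atTop hγ).comp Real.tendsto_log_atTop

/-- The square of this function is the reciprocal of `(x / M x) / A x ^ 2`, which tends to `0` from
above. -/
theorem tendsto_mul_sqrt_atTop {A M : ℝ → ℝ} (hA : ∀ x, 0 < x → 0 < A x)
    (hM : ∀ x, 0 < x → 0 < M x)
    (hMA : (fun x => x / M x) =o[atTop] fun x => A x ^ 2) :
    Tendsto (fun x => A x * √(M x / x)) atTop atTop := by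
  have h1 : Tendsto (fun x => x / M x / A x ^ 2) atTop (𝓝[>] 0) := by
    refine tendsto_nhdsWithin_iff.2 ⟨hMA.tendsto_div_nhds_zero, ?_⟩
    filter_upwards [eventually_gt_atTop 0] with x hx
    have := hA x hx
    have := hM x hx
    exact mem_Ioi.2 (by positivity)
  refine (Real.tendsto_sqrt_atTop.comp h1.inv_tendsto_nhdsGT_zero).congr' ?_
  filter_upwards [eventually_gt_atTop 0] with x hx
  have hAx := hA x hx
  have hMx := hM x hx
  simp only [Function.comp_apply, Pi.inv_apply]
  have h2 : (x / M x / A x ^ 2)⁻¹ = A x ^ 2 * (M x / x) := by field_simp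
  rw [h2, Real.sqrt_mul (by positivity), Real.sqrt_sq hAx.le]

/-! ### The two choices of truncation level. -/

theorem mainTheorem6 (F : Measure ℝ) [IsProbabilityMeasure F]
    (α : ℝ) (hα0 : 0 < α) (hα : α ≤ 1 / 2)
    (A : ℝ → ℝ) (hA : IsRegVar α A)
    (hF : tailFn F ~[atTop] fun x => 1 / A x)
    (h : ℝ) (hh : IsWindow F h)
    (β : ℝ) (hβ : β ∈ Icc (1 - 2 * α) 1)
    (M : ℝ → ℝ) (hM : IsRegVar β M) (hMmono : MonotoneOn M (Ioi 0))
    (hω : omegaFn F h =O[atTop] fun x => x / M x)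
    (hMA : (fun x => x / M x) =o[atTop] fun x => A x ^ 2)
    (g : ℝ → ℝ) (hg : ∀ x, g x = A x * √(M x / x)) :
    (∀ γ : ℝ, α + β < γ → ((fun x => Real.log x ^ γ) =O[atTop] g) →
      ∀ θ : ℝ, 0 < θ → ∀ L : ℝ → ℝ, (∃ ρ, IsRegVar ρ L) → MonotoneOn L (Ioi 0) →
        (L =O[atTop] fun x => g x / Real.log x ^ γ) → UniformCutoff F A h θ L) ∧
    (∀ ε ∈ Ioo (0 : ℝ) (1 / (1 + α + β)),
      ∀ θ : ℝ, 0 < θ → ∀ L : ℝ → ℝ, (∃ ρ, IsRegVar ρ L) → MonotoneOn L (Ioi 0) →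
        ((fun _ => (1 : ℝ)) =O[atTop] L) → (L =O[atTop] fun x => g x ^ ε) →
        UniformCutoff F A h θ L) := by
  have hβ0 : 0 ≤ β := by linarith [hβ.1]
  have hα1 : α < 1 := by linarith
  have hAT := tendsto_mul_of_isEquivalent_one_div hA.pos hF
  have hTpos := tailFn_pos_of_tendsto_mul F hA.pos hAT
  have hT2 := tendsto_ratio_two_of_tendsto_mul hA hAT
  obtain ⟨C₁, hC₁, hloc⟩ := exists_local_bound_of_omegaFn F hTpos hM.pos hω
  obtain ⟨C₂, hC₂, hMx⟩ :=
    exists_le_mul_of_local_bound F hα0 hh.1 hC₁ hTpos hT2 hM.pos hMmono hloc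
  have hTinv := exists_one_div_tailFn_le F hα1 hTpos hT2
  have hgsq : ∀ x, 0 < x → g x ^ 2 = A x ^ 2 * (M x / x) := fun x hx => by
    have := hM.pos x hx
    rw [hg, mul_pow, Real.sq_sqrt (by positivity)]
  have hgpos : ∀ x, 0 < x → 0 < g x := fun x hx => by
    have := hM.pos x hx
    have := hA.pos x hx
    rw [hg]; positivity
  -- Since `M x = O(x)`, `g` is at most of order `A`, so `g * T` stays bounded; this drives the
  -- Chernoff condition in both parts.
  have hgA : ∀ᶠ x in atTop, g x ≤ √C₂ * A x := by
    filter_upwards [hMx, eventually_gt_atTop 0] with x hx hx0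
    rw [hg, mul_comm]
    have := hA.pos x hx0
    gcongr
    exact (div_le_iff₀ hx0).2 hx
  have hgtop : Tendsto g atTop atTop :=
    (tendsto_mul_sqrt_atTop hA.pos hM.pos hMA).congr fun x => (hg x).symm
  have hAT2 : ∀ᶠ x in atTop, tailFn F x * A x ≤ 2 := hAT.eventually_le_const one_lt_two
  constructor
  · rintro γ hγ - θ hθ L ⟨ρ, hL⟩ - hLg
    have hγ0 : 0 < γ := by linarith
    obtain ⟨C₃, hC₃, hLb⟩ := hLg.exists_pos
    obtain ⟨x₀, hx₀, hpot⟩ := exists_potter_div_tailFn F hTpos hT2 hM hMmono hγ0.le hγ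
    have hLb' : ∀ᶠ x in atTop, L x ≤ C₃ * (g x * Real.log x ^ (-γ)) := by
      filter_upwards [hLb.bound, eventually_gt_atTop 1] with x hx hx1
      have hlog := Real.log_pos hx1
      have := hgpos x (by linarith)
      rw [Real.norm_of_nonneg (show 0 ≤ g x / Real.log x ^ γ by positivity)] at hx
      rw [Real.rpow_neg hlog.le, ← div_eq_mul_inv]
      exact (le_abs_self _).trans hx
    have hz : Tendsto (fun x => x / Real.log x) atTop atTop := by
      have h1 : Tendsto (fun x => Real.log x / x) atTop (𝓝[>] 0) := by
        refine tendsto_nhdsWithin_iff.2 ⟨Real.isLittleO_log_id_atTop.tendsto_div_nhds_zero, ?_⟩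
        filter_upwards [eventually_gt_atTop 1] with x hx
        exact mem_Ioi.2 (div_pos (Real.log_pos hx) (by linarith))
      exact h1.inv_tendsto_nhdsGT_zero.congr fun x => by simp
    refine uniformCutoff_of_truncation F hα1 (z := fun x => x / Real.log x) hθ hA.pos hTpos hAT
      hT2 hTinv hM.pos hMmono hC₁ hloc hz ?_ hL.pos ?_ ?_
    · filter_upwards [Real.tendsto_log_atTop.eventually_ge_atTop 1, eventually_ge_atTop 0]
        with x hx hx0
      exact div_le_self hx0 hx
    -- `L²` brings `(log x)^(-2γ)`, and moving `T / M` from `x / (2 log x)` to `x` costs `(log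
    -- x)^γ`; one factor `(log x)^(-γ)` survives.
    · have hlim := (tendsto_log_rpow_neg hγ0).const_mul (C₃ ^ 2 * 2 ^ 2 * (2 ^ γ * 2 ^ γ))
      rw [mul_zero] at hlim
      refine squeeze_zero' ?_ ?_ hlim
      · filter_upwards [eventually_gt_atTop 0, hz.eventually_gt_atTop 0] with x hx hzx
        have := hTpos x
        have := hTpos (x / Real.log x / 2)
        have := hM.pos (x / Real.log x / 2) (by linarith)
        positivity
      · filter_upwards [eventually_gt_atTop 1, hz.eventually_ge_atTop (2 * x₀), hLb', hAT2,
          Real.tendsto_log_atTop.eventually_ge_atTop 1] with x hx1 hzx hLx hATx hlog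
        have hx0 : 0 < x := by linarith
        have hlog0 : 0 < Real.log x := by linarith
        have hw0 : 0 < x / Real.log x / 2 := by linarith
        have hwx : x / Real.log x / 2 ≤ x := by
          have := div_le_self hx0.le hlog
          linarith
        have hp := hpot (x / Real.log x / 2) (by linarith) x hwx
        set w := x / Real.log x / 2 with hw
        have hTx := hTpos x
        have hTw := hTpos w
        have hMx := hM.pos x hx0
        have hMw := hM.pos w hw0
        have hAx := hA.pos x hx0
        have hLx0 := hL.pos x hx0
        have hxw : x / w = 2 * Real.log x := by rw [hw]; field_simp
        rw [hxw, Real.mul_rpow two_pos.le hlog0.le] at hp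
        set ℓ := Real.log x ^ γ with hℓ
        have hℓ0 : 0 < ℓ := by positivity
        have hℓi : Real.log x ^ (-γ) = ℓ⁻¹ := Real.rpow_neg hlog0.le γ
        rw [hℓi] at hLx ⊢
        have hp' : M x / tailFn F x * (tailFn F w / M w) ≤ 2 ^ γ * (2 ^ γ * ℓ) := by
          calc M x / tailFn F x * (tailFn F w / M w)
              ≤ 2 ^ γ * (2 ^ γ * ℓ) * (M w / tailFn F w) * (tailFn F w / M w) := by gcongr
            _ = _ := by field_simp
        calc L x ^ 2 * (x * tailFn F x) * (tailFn F w / M w)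
            ≤ (C₃ * (g x * ℓ⁻¹)) ^ 2 * (x * tailFn F x) * (tailFn F w / M w) := by gcongr
          _ = C₃ ^ 2 * (tailFn F x * A x) ^ 2 * ℓ⁻¹ ^ 2 *
                (M x / tailFn F x * (tailFn F w / M w)) := by
              rw [mul_pow, mul_pow, hgsq x hx0]; field_simp
          _ ≤ C₃ ^ 2 * 2 ^ 2 * ℓ⁻¹ ^ 2 * (2 ^ γ * (2 ^ γ * ℓ)) := by gcongr
          _ = _ := by field_simp
    · have hlim := (tendsto_log_rpow_neg hγ0).const_mul (C₃ * √C₂ * 2 * Real.exp (6 / θ))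
      rw [mul_zero] at hlim
      refine squeeze_zero' ?_ ?_ hlim
      · filter_upwards [eventually_gt_atTop 0] with x hx
        have := hTpos x
        have := hL.pos x hx
        positivity
      · filter_upwards [eventually_gt_atTop 1, hLb', hAT2, hgA] with x hx1 hLx hATx hgAx
        have hx0 : 0 < x := by linarith
        have hlog := Real.log_pos hx1
        have hTx := hTpos x
        have hexp : 6 / θ * Real.log x / x * (x / Real.log x) = 6 / θ := by field_simp
        rw [hexp]
        calc L x * tailFn F x * Real.exp (6 / θ)
            ≤ C₃ * (√C₂ * A x * Real.log x ^ (-γ)) * tailFn F x * Real.exp (6 / θ) := by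
              gcongr
              exact hLx.trans (by gcongr)
          _ = C₃ * √C₂ * (tailFn F x * A x) * Real.exp (6 / θ) * Real.log x ^ (-γ) := by ring
          _ ≤ C₃ * √C₂ * 2 * Real.exp (6 / θ) * Real.log x ^ (-γ) := by gcongr
  · rintro ε ⟨hε0, hε⟩ θ hθ L ⟨ρ, hL⟩ - - hLg
    have hε1 : ε < 1 := hε.trans_le ((div_le_one (by linarith)).2 (by linarith))
    have hε' : 0 < 1 - ε := by linarith
    obtain ⟨C₃, hC₃, hLb⟩ := hLg.exists_pos
    -- Any exponent above `α + β` would do: the Potter ratio `x / w = 2 / δ` is constant here.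
    set σ := α + β + 1 with hσ
    have hσ0 : 0 < σ := by linarith
    obtain ⟨x₀, hx₀, hpot⟩ :=
      exists_potter_div_tailFn F hTpos hT2 hM hMmono hσ0.le (show α + β < σ by linarith)
    obtain ⟨C₄, hC₄, hTle⟩ := (antitone_tailFn F).exists_le_rpow hTpos
      (σ := -(α / 2)) (by linarith) (by linarith) hT2
    have hLb' : ∀ᶠ x in atTop, L x ≤ C₃ * g x ^ ε := by
      filter_upwards [hLb.bound, eventually_gt_atTop 0] with x hx hx0
      have := hgpos x hx0
      rw [Real.norm_of_nonneg (show 0 ≤ g x ^ ε by positivity)] at hx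
      exact (le_abs_self _).trans hx
    -- The `24` makes the exponential factor at most `x ^ ((1 - ε) * α / 4)`, half the decay
    -- exponent of `T ^ (1 - ε)` obtained from `T ≤ C₄ * x ^ (-(α / 2))`.
    set δ := min 1 (θ * (1 - ε) * α / 24) with hδ
    have hδ0 : 0 < δ := by positivity
    have hδ1 : δ ≤ 1 := min_le_left _ _
    have hδ2 : 6 / θ * δ ≤ (1 - ε) * α / 4 := by
      calc 6 / θ * δ ≤ 6 / θ * (θ * (1 - ε) * α / 24) := by gcongr; exact min_le_right _ _
        _ = _ := by field_simp; ring
    have hz : Tendsto (fun x : ℝ => δ * x) atTop atTop := tendsto_id.const_mul_atTop hδ0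
    refine uniformCutoff_of_truncation F hα1 (z := fun x => δ * x) hθ hA.pos hTpos hAT
      hT2 hTinv hM.pos hMmono hC₁ hloc hz ?_ hL.pos ?_ ?_
    · filter_upwards [eventually_ge_atTop 0] with x hx0
      exact mul_le_of_le_one_left hx0 hδ1
    · have hlim := ((tendsto_rpow_neg_atTop (show 0 < 2 * (1 - ε) by linarith)).comp
        hgtop).const_mul (C₃ ^ 2 * 2 ^ 2 * (2 ^ σ * (2 / δ) ^ σ))
      rw [mul_zero] at hlim
      refine squeeze_zero' ?_ ?_ hlim
      · filter_upwards [eventually_gt_atTop 0] with x hx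
        have := hTpos x
        have := hTpos (δ * x / 2)
        have := hM.pos (δ * x / 2) (by positivity)
        positivity
      · filter_upwards [eventually_gt_atTop 0, hz.eventually_ge_atTop (2 * x₀), hLb', hAT2]
          with x hx0 hzx hLx hATx
        have hw0 : 0 < δ * x / 2 := by positivity
        have hwx : δ * x / 2 ≤ x := by nlinarith
        have hp := hpot (δ * x / 2) (by linarith) x hwx
        set w := δ * x / 2 with hw
        have hTx := hTpos x
        have hTw := hTpos w
        have hMx := hM.pos x hx0
        have hMw := hM.pos w hw0
        have hAx := hA.pos x hx0
        have hLx0 := hL.pos x hx0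
        have hgx := hgpos x hx0
        have hxw : x / w = 2 / δ := by rw [hw]; field_simp
        rw [hxw] at hp
        have hp' : M x / tailFn F x * (tailFn F w / M w) ≤ 2 ^ σ * (2 / δ) ^ σ := by
          calc M x / tailFn F x * (tailFn F w / M w)
              ≤ 2 ^ σ * (2 / δ) ^ σ * (M w / tailFn F w) * (tailFn F w / M w) := by gcongr
            _ = _ := by field_simp
        have hgε : (g x ^ ε) ^ 2 = g x ^ 2 * g x ^ (-(2 * (1 - ε))) := by
          rw [← Real.rpow_natCast (g x ^ ε), ← Real.rpow_natCast (g x), ← Real.rpow_mul hgx.le,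
            ← Real.rpow_add hgx]
          congr 1
          push_cast
          ring
        simp only [Function.comp_apply]
        calc L x ^ 2 * (x * tailFn F x) * (tailFn F w / M w)
            ≤ (C₃ * g x ^ ε) ^ 2 * (x * tailFn F x) * (tailFn F w / M w) := by gcongr
          _ = C₃ ^ 2 * (tailFn F x * A x) ^ 2 *
                (M x / tailFn F x * (tailFn F w / M w)) * g x ^ (-(2 * (1 - ε))) := by
              rw [mul_pow, hgε, hgsq x hx0]; field_simp
          _ ≤ C₃ ^ 2 * 2 ^ 2 * (2 ^ σ * (2 / δ) ^ σ) * g x ^ (-(2 * (1 - ε))) := by gcongr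
    · have hlim := (tendsto_rpow_neg_atTop (show 0 < (1 - ε) * α / 4 by positivity)).const_mul
        (C₃ * (√C₂ * 2) ^ ε * C₄ ^ (1 - ε))
      rw [mul_zero] at hlim
      refine squeeze_zero' ?_ ?_ hlim
      · filter_upwards [eventually_gt_atTop 0] with x hx
        have := hTpos x
        have := hL.pos x hx
        positivity
      · filter_upwards [eventually_ge_atTop 1, hLb', hAT2, hgA, hTle]
          with x hx1 hLx hATx hgAx hTlex
        have hx0 : 0 < x := by linarith
        have hTx := hTpos x
        have hgx := hgpos x hx0
        have hlog := Real.log_nonneg hx1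
        have hexp : Real.exp (6 / θ * Real.log x / x * (δ * x)) ≤ x ^ ((1 - ε) * α / 4) := by
          rw [Real.rpow_def_of_pos hx0]
          apply Real.exp_le_exp.2
          calc 6 / θ * Real.log x / x * (δ * x) = Real.log x * (6 / θ * δ) := by field_simp
            _ ≤ _ := by gcongr
        have hgT : g x ^ ε * tailFn F x ≤ (√C₂ * 2) ^ ε * (C₄ ^ (1 - ε) *
            x ^ (-((1 - ε) * α / 2))) := by
          -- The factor `(g T) ^ ε` is bounded, while the remaining `T ^ (1 - ε)` decays like a
          -- power of `x`.
          have e1 : g x ^ ε * tailFn F x = (g x * tailFn F x) ^ ε * tailFn F x ^ (1 - ε) := by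
            rw [Real.mul_rpow hgx.le hTx.le, mul_assoc, ← Real.rpow_add hTx]
            simp
          have e2 : g x * tailFn F x ≤ √C₂ * 2 := by
            calc g x * tailFn F x ≤ √C₂ * A x * tailFn F x := by gcongr
              _ = √C₂ * (tailFn F x * A x) := by ring
              _ ≤ _ := by gcongr
          have e3 : tailFn F x ^ (1 - ε) ≤ C₄ ^ (1 - ε) * x ^ (-((1 - ε) * α / 2)) := by
            refine (Real.rpow_le_rpow hTx.le hTlex hε'.le).trans (le_of_eq ?_)
            rw [Real.mul_rpow hC₄.le (by positivity), ← Real.rpow_mul hx0.le]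
            congr 2
            ring
          rw [e1]
          gcongr
        calc L x * tailFn F x * Real.exp (6 / θ * Real.log x / x * (δ * x))
            ≤ C₃ * g x ^ ε * tailFn F x * x ^ ((1 - ε) * α / 4) := by gcongr
          _ = C₃ * (g x ^ ε * tailFn F x) * x ^ ((1 - ε) * α / 4) := by ring
          _ ≤ C₃ * ((√C₂ * 2) ^ ε * (C₄ ^ (1 - ε) * x ^ (-((1 - ε) * α / 2)))) *
                x ^ ((1 - ε) * α / 4) := by gcongr
          _ = C₃ * (√C₂ * 2) ^ ε * C₄ ^ (1 - ε) *
                (x ^ (-((1 - ε) * α / 2)) * x ^ ((1 - ε) * α / 4)) := by ring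
          _ = _ := by
              rw [← Real.rpow_add hx0]
              congr 2
              ring
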